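/- For a group $\Gamma$ and a representation $A$ of $\Gamma$ over $\mathbb{Q}$ such that $H^i(\Gamma,A)$ is finite-dimensional for every $i\ge 0$ and nonzero for only finitely many $i$, let $\chi_h(\Gamma,A)=\sum_{i\ge 0}(-1)^i\dim_{\mathbb{Q}}H^i(\Gamma,A)$ denote its homological Euler characteristic. Let $V_2=\mathbb{Q}^2$ be the standard representation of $GL_2(\mathbb{Z})$, let $S^mV_2$ be its $m$-th symmetric power, and let $\det$ be the one-dimensional determinant representation of $GL_2(\mathbb{Z})$ over $\mathbb{Q}$. Then for every $m\ge 0$ the cohomology groups of $GL_2(\mathbb{Z})$ with coefficients in $S^mV_2$ and in $S^mV_2\otimes\det$ are finite-dimensional, and only finitely many of them are nonzero. Moreover, for every integer $n\ge 0$ and every $k$ that is one of $0,2,4,6,8,10$ or an odd positive integer, $$\chi_h(GL_2(\mathbb{Z}),S^{12n+k}V_2)=\begin{cases}-n+1 & k=0,\\ -n & k=2,4,6,8,\\ -n-1 & k=10,\\ 0 & k\text{ odd},\end{cases}$$ and $$\chi_h(GL_2(\mathbb{Z}),S^{12n+k}V_2\otimes\det)=\begin{cases}-n & k=0,\\ -n-1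 & k=2,4,6,8,\\ -n-2 & k=10,\\ 0 & k\text{ odd}.\end{cases}$$ -/

import Mathlib

open scoped TensorProduct

noncomputable section

namespace SymmetricPower

/-- The linear map `Symⁿ V → Symⁿ W` induced by a linear map `f : V → W`, sending
`v₁ ⋯ vₙ` to `f v₁ ⋯ f vₙ`. -/
def map {R V W : Type} [CommRing R] [AddCommGroup V] [Module R V] [AddCommGroup W] [Module R W]
    (n : ℕ) (f : V →ₗ[R] W) : SymmetricPower R (Fin n) V →ₗ[R] SymmetricPower R (Fin n) W where
  __ := AddCon.lift (addConGen (SymmetricPower.Rel R (Fin n) V))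
    ((SymmetricPower.mk R (Fin n) W).comp (PiTensorProduct.map fun _ => f)).toAddMonoidHom
    (by
      refine AddCon.addConGen_le.2 ?_
      intro x y h
      cases h with
      | perm e g =>
        simp only [AddCon.ker_rel, LinearMap.toAddMonoidHom_coe, LinearMap.comp_apply,
          PiTensorProduct.map_tprod]
        exact (SymmetricPower.tprod_equiv e fun i => f (g i)).symm)
  map_smul' r x := by
    induction x using AddCon.induction_on with
    | H x =>
      exact ((SymmetricPower.mk R (Fin n) W).comp (PiTensorProduct.map fun _ => f)).map_smul r x

theorem map_tprod {R V W : Type} [CommRing R] [AddCommGroup V] [Module R V] [AddCommGroup W]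
    [Module R W] (n : ℕ) (f : V →ₗ[R] W) (v : Fin n → V) :
    map n f (SymmetricPower.tprod R v) = SymmetricPower.tprod R fun i => f (v i) :=
  congrArg (SymmetricPower.mk R (Fin n) W) (PiTensorProduct.map_tprod (fun _ => f) v)

theorem hom_ext {R V W : Type} [CommRing R] [AddCommGroup V] [Module R V] [AddCommGroup W]
    [Module R W] {n : ℕ} {f g : SymmetricPower R (Fin n) V →ₗ[R] W}
    (h : ∀ v : Fin n → V, f (SymmetricPower.tprod R v) = g (SymmetricPower.tprod R v)) :
    f = g :=
  LinearMap.ext_on_range (SymmetricPower.span_tprod_eq_top R (Fin n) V) h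

end SymmetricPower

/-- The `n`-th symmetric power `Symⁿ V` of a representation `V` of a group `G`:
`g • (v₁ ⋯ vₙ) = (g • v₁) ⋯ (g • vₙ)`. -/
def Representation.symPow {R G V : Type} [CommRing R] [Group G] [AddCommGroup V] [Module R V]
    (ρ : Representation R G V) (n : ℕ) : Representation R G (SymmetricPower R (Fin n) V) where
  toFun g := SymmetricPower.map n (ρ g)
  map_one' := SymmetricPower.hom_ext fun v => by simp [SymmetricPower.map_tprod]
  map_mul' g h := SymmetricPower.hom_ext fun v => by simp [SymmetricPower.map_tprod]

/-- The standard representation `V₂` of `GL₂(ℤ)` on `ℚ²`. -/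
def standardRep : Representation ℚ (GL (Fin 2) ℤ) (Fin 2 → ℚ) where
  toFun g := Matrix.toLin' ((g : Matrix (Fin 2) (Fin 2) ℤ).map (Int.cast : ℤ → ℚ))
  map_one' := by simp [Module.End.one_eq_id]
  map_mul' g h := by
    rw [Module.End.mul_eq_comp, ← Matrix.toLin'_mul]
    exact congrArg _ (Matrix.map_mul (f := Int.castRingHom ℚ))

/-- The one-dimensional determinant representation of `GL₂(ℤ)` on `ℚ`. -/
def detRep : Representation ℚ (GL (Fin 2) ℤ) ℚ where
  toFun g := (((g : Matrix (Fin 2) (Fin 2) ℤ).det : ℤ) : ℚ) • LinearMap.id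
  map_one' := by ext; simp
  map_mul' g h := by ext; simp [mul_comm]

/-- `Sᵐ V₂` as a representation of `GL₂(ℤ)` over `ℚ`. -/
def symV (m : ℕ) : Rep ℚ (GL (Fin 2) ℤ) := Rep.of (standardRep.symPow m)

/-- `Sᵐ V₂ ⊗ det` as a representation of `GL₂(ℤ)` over `ℚ`. -/
def symVDet (m : ℕ) : Rep ℚ (GL (Fin 2) ℤ) :=
  CategoryTheory.MonoidalCategory.tensorObj (symV m) (Rep.of detRep)

/-- The total cohomology of `G` with coefficients in `A` is finite-dimensional, that is, the
homological Euler characteristic is a finite sum of finite dimensions. -/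
def HasFiniteCohomology {G : Type} [Group G] (A : Rep ℚ G) : Prop :=
  (∀ i : ℕ, Module.Finite ℚ (groupCohomology A i)) ∧
    {i : ℕ | Nontrivial (groupCohomology A i)}.Finite

/-- The homological Euler characteristic `χ_h(G, A) = ∑ᵢ (-1)ⁱ dim Hⁱ(G, A)`; it is meaningful
when `HasFiniteCohomology A` holds. -/
def homologicalEulerChar {G : Type} [Group G] (A : Rep ℚ G) : ℤ :=
  ∑ᶠ i : ℕ, (-1 : ℤ) ^ i * (Module.finrank ℚ (groupCohomology A i) : ℤ)

end

/-! `GL₂(ℤ)` is the amalgam of dihedral groups of orders `8` and `12` over their intersection,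
of order `4`, so it acts on a tree whose vertex and edge stabilizers are conjugates of these three
groups. Over `ℚ` the permutation module of a `G`-set with finite stabilizers is projective, so the
chain complex of the tree is a projective resolution of length one of the trivial representation,
and `χ_h(M) = dim M^{D₈} + dim M^{D₁₂} - dim M^{D₄}`. Averaging characters turns the right-hand
side into a sum over torsion classes; the character of `Sᵐ V₂` at `g` satisfies the recurrence
`h_{m+2} = tr(g) h_{m+1} - det(g) h_m`, which is periodic in `m` at all of them except `±1`.
-/

open CategoryTheory Limits MulAction

section PermutationModules

universe u

variable {k G : Type u} [CommRing k] [Group G] {X Y : Type u} [MulAction G X] [MulAction G Y]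
  (M : Rep.{u} k G)

/-- The vectors fixed by a subgroup `H`, written `M^H` in the literature. -/
noncomputable def fixedVectors (H : Subgroup G) : Submodule k M :=
  Representation.invariants (MonoidHom.comp M.ρ H.subtype)

variable (X) in
/-- The equivariant maps from a `G`-set `X` to a representation `M`; they are the morphisms
`k[X] ⟶ M`, see `ofMulActionHomEquiv`. -/
def equivariantMaps : Submodule k (X → M) where
  carrier := {f | ∀ (g : G) (x : X), f (g • x) = M.ρ g (f x)}
  add_mem' hf hf' g x := by simp [hf g x, hf' g x]
  zero_mem' g x := by simp
  smul_mem' r f hf g x := by simp [hf g x]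

variable {M}

theorem mem_fixedVectors {H : Subgroup G} {v : M} :
    v ∈ fixedVectors M H ↔ ∀ h ∈ H, M.ρ h v = v :=
  ⟨fun hv h hh => hv ⟨h, hh⟩, fun hv h => hv h.1 h.2⟩

/-- The universal property of the permutation module `k[X]`. -/
noncomputable def ofMulActionHomEquiv :
    (Rep.ofMulAction k G X ⟶ M) ≃ₗ[k] equivariantMaps X M where
  toFun f := ⟨fun x => f.hom (MonoidAlgebra.single x 1), fun g x => by
    rw [← Rep.hom_comm_apply]; simp⟩
  map_add' _ _ := rfl
  map_smul' _ _ := rfl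
  invFun f := Rep.ofHom
    ⟨Finsupp.linearCombination k f.1 ∘ₗ (MonoidAlgebra.coeffLinearEquiv k).toLinearMap,
      fun g => by ext x; simp [f.2 g x]⟩
  left_inv f := by ext x; simp
  right_inv f := by ext x; simp

theorem ofMulActionHomEquiv_symm_single (f : equivariantMaps X M) (x : X) (r : k) :
    (ofMulActionHomEquiv.symm f).hom (MonoidAlgebra.single x r) = r • f.1 x := by
  simp [ofMulActionHomEquiv]

variable (X Y M) in
/-- An equivariant map on a disjoint union is a pair of equivariant maps. -/
def equivariantMapsSumEquiv :
    equivariantMaps (X ⊕ Y) M ≃ₗ[k] equivariantMaps X M × equivariantMaps Y M where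
  toFun f := (⟨fun x => f.1 (.inl x), fun g x => f.2 g (.inl x)⟩,
    ⟨fun y => f.1 (.inr y), fun g y => f.2 g (.inr y)⟩)
  map_add' _ _ := rfl
  map_smul' _ _ := rfl
  invFun p := ⟨Sum.elim p.1.1 p.2.1, fun g x => by
    rcases x with x | y
    exacts [p.1.2 g x, p.2.2 g y]⟩
  left_inv f := by ext (x | y) <;> rfl
  right_inv _ := rfl

variable (M) in
/-- Frobenius reciprocity: an equivariant map on `G ⧸ H` is determined by its value at the trivial
coset, which is an arbitrary vector fixed by `H`. -/
noncomputable def equivariantMapsQuotientEquiv (H : Subgroup G) :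
    equivariantMaps (G ⧸ H) M ≃ₗ[k] fixedVectors M H where
  toFun f := ⟨f.1 (1 : G), mem_fixedVectors.2 fun h hh => by
    rw [← f.2, MulAction.Quotient.smul_coe, smul_eq_mul, mul_one,
      (QuotientGroup.eq (a := h) (b := 1)).2 (by simpa using hh)]⟩
  map_add' _ _ := rfl
  map_smul' _ _ := rfl
  invFun v := ⟨Quotient.lift (fun g => M.ρ g v.1) fun a b hab => by
      have h := congrArg (M.ρ a) (mem_fixedVectors.1 v.2 _ (QuotientGroup.leftRel_apply.1 hab))
      rw [← Module.End.mul_apply, ← map_mul, mul_inv_cancel_left] at h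
      exact h.symm,
    fun g x => by
      induction x using QuotientGroup.induction_on with
      | H x => exact LinearMap.congr_fun (map_mul M.ρ g x) v.1⟩
  left_inv f := by
    ext x
    induction x using QuotientGroup.induction_on with
    | H x =>
      refine (f.2 x (1 : G)).symm.trans ?_
      rw [MulAction.Quotient.smul_coe, smul_eq_mul, mul_one]
  right_inv v := by
    ext
    exact LinearMap.congr_fun (map_one M.ρ) v.1

theorem card_setOf_smul_eq {x₀ x : X} (hx : x ∈ orbit G x₀) :
    Nat.card {g : G | g • x₀ = x} = Nat.card (stabilizer G x₀) := by
  obtain ⟨a, rfl⟩ := hx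
  refine Nat.card_congr (((Equiv.mulLeft a⁻¹).subtypeEquiv fun g => ?_))
  simp [mem_stabilizer_iff, mul_smul, inv_smul_eq_iff]

theorem finite_setOf_smul_eq {x₀ x : X} [Finite (stabilizer G x₀)] (hx : x ∈ orbit G x₀) :
    {g : G | g • x₀ = x}.Finite :=
  Set.finite_coe_iff.1 <| Nat.finite_of_card_ne_zero <| by
    rw [card_setOf_smul_eq hx]; exact Nat.card_pos.ne'

/-- The sum of the translates `g • v` over all `g` that move `x₀` to `x`. It is zero by convention
if there are infinitely many of them. -/
noncomputable def transporterSum (x₀ x : X) (v : M) : M :=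
  ∑ᶠ g ∈ {g : G | g • x₀ = x}, M.ρ g v

theorem transporterSum_smul {x₀ x : X} [Finite (stabilizer G x₀)] (hx : x ∈ orbit G x₀) (a : G)
    (v : M) : transporterSum x₀ (a • x) v = M.ρ a (transporterSum x₀ x v) := by
  refine Eq.trans (Eq.symm ?_)
    ((M.ρ a).toAddMonoidHom.map_finsum_mem _ (finite_setOf_smul_eq hx)).symm
  refine finsum_mem_eq_of_bijOn (a * ·) ⟨fun g hg => ?_, (mul_right_injective a).injOn,
    fun g hg => ⟨a⁻¹ * g, ?_, mul_inv_cancel_left a g⟩⟩ fun g _ => ?_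
  · simpa [mul_smul] using hg
  · simpa [mul_smul, inv_smul_eq_iff] using hg
  · exact (LinearMap.congr_fun (map_mul M.ρ a g) v).symm

theorem hom_transporterSum {N : Rep.{u} k G} (p : M ⟶ N) {f : X → N} (hf : f ∈ equivariantMaps X N)
    {x₀ x : X} [Finite (stabilizer G x₀)] (hx : x ∈ orbit G x₀) {v : M} (hv : p.hom v = f x₀) :
    p.hom (transporterSum x₀ x v) = (Nat.card (stabilizer G x₀) : k) • f x := by
  have value (g : G) (hg : g ∈ {g : G | g • x₀ = x}) : p.hom (M.ρ g v) = f x := by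
    rw [Rep.hom_comm_apply, hv, ← hf, hg]
  have hfin := finite_setOf_smul_eq hx
  refine (p.hom.toLinearMap.toAddMonoidHom.map_finsum_mem _ hfin).trans
    ((finsum_mem_congr rfl value).trans ?_)
  rw [finsum_mem_eq_finite_toFinset_sum _ hfin, Finset.sum_const,
    ← Set.ncard_eq_toFinset_card _ hfin, ← Nat.card_coe_set_eq, card_setOf_smul_eq hx,
    Nat.cast_smul_eq_nsmul]

/-- The lift sends `x` to the mean of the translates `g • ℓ` over all `g` that move `x₀` to `x`,
where `x₀` is a chosen point of the orbit of `x` and `ℓ` a preimage of `f x₀`. -/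
theorem exists_equivariant_lift [∀ x : X, Finite (stabilizer G x)]
    (hX : ∀ x : X, IsUnit (Nat.card (stabilizer G x) : k)) {N : Rep.{u} k G} (p : M ⟶ N)
    (hp : Function.Surjective p.hom) {f : X → N} (hf : f ∈ equivariantMaps X N) :
    ∃ f' ∈ equivariantMaps X M, ∀ x, p.hom (f' x) = f x := by
  let rep (x : X) : X := (Quotient.mk (orbitRel G X) x).out
  have mem_orbit_rep (x : X) : x ∈ orbit G (rep x) :=
    (orbitRel G X).symm (Quotient.mk_out (s := orbitRel G X) x)
  have rep_smul (g : G) (x : X) : rep (g • x) = rep x :=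
    congrArg Quotient.out (Quotient.sound (mem_orbit x g))
  choose ℓ hℓ using fun x => hp (f x)
  refine ⟨fun x => Ring.inverse (Nat.card (stabilizer G (rep x)) : k) •
    transporterSum (rep x) x (ℓ (rep x)), fun a x => ?_, fun x => ?_⟩
  · beta_reduce
    rw [map_smul, rep_smul, transporterSum_smul (mem_orbit_rep x)]
  · rw [map_smul, hom_transporterSum p hf (mem_orbit_rep x) (hℓ _), smul_smul,
      Ring.inverse_mul_cancel _ (hX _), one_smul]

theorem projective_ofMulAction [∀ x : X, Finite (stabilizer G x)]
    (hX : ∀ x : X, IsUnit (Nat.card (stabilizer G x) : k)) :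
    Projective (Rep.ofMulAction k G X) where
  factors f p hp := by
    obtain ⟨f', hf', h⟩ := exists_equivariant_lift hX p ((Rep.epi_iff_surjective p).1 hp)
      (ofMulActionHomEquiv f).2
    refine ⟨ofMulActionHomEquiv.symm ⟨f', hf'⟩, ofMulActionHomEquiv.injective ?_⟩
    ext x
    exact (congrArg p.hom (ofMulActionHomEquiv_symm_single ⟨f', hf'⟩ x 1)).trans
      (by simpa using h x)

instance projective_ofMulAction_of_charZero {k : Type u} [Field k] [CharZero k]
    [∀ x : X, Finite (stabilizer G x)] : Projective (Rep.ofMulAction k G X) :=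
  projective_ofMulAction fun x =>
    (Nat.cast_ne_zero.2 (Nat.card_pos (α := stabilizer G x)).ne').isUnit

instance finite_stabilizer_sum [hX : ∀ x : X, Finite (stabilizer G x)]
    [hY : ∀ y : Y, Finite (stabilizer G y)] (z : X ⊕ Y) : Finite (stabilizer G z) := by
  rcases z with x | y
  · rw [show stabilizer G (Sum.inl x : X ⊕ Y) = stabilizer G x by ext; simp]
    exact hX x
  · rw [show stabilizer G (Sum.inr y : X ⊕ Y) = stabilizer G y by ext; simp]
    exact hY y

instance finite_stabilizer_quotient (H : Subgroup G) [Finite H] (x : G ⧸ H) :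
    Finite (stabilizer G x) := by
  induction x using QuotientGroup.induction_on with
  | H g =>
    have : Finite (stabilizer G ((1 : G) : G ⧸ H)) := by rwa [stabilizer_quotient]
    refine Finite.of_equiv _
      (stabilizerEquivStabilizer (g := g) (a := ((1 : G) : G ⧸ H)) ?_).toEquiv
    rw [Quotient.smul_coe, smul_eq_mul, mul_one]

end PermutationModules

section TwoTermComplexes

open scoped ZeroObject

universe v u

variable {C : Type u} [Category.{v} C] [Abelian C] (S : ShortComplex C)

/-- The complex `⋯ ⟶ 0 ⟶ S.X₁ ⟶ S.X₂`, with `S.X₂` in degree `0`. -/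
noncomputable def twoTermComplex : ChainComplex C ℕ :=
  ChainComplex.of (fun | 0 => S.X₂ | 1 => S.X₁ | _ + 2 => 0) (fun | 0 => S.f | _ + 1 => 0)
    fun _ => zero_comp

theorem twoTermComplex_d : (twoTermComplex S).d 1 0 = S.f := by
  dsimp only [twoTermComplex, ChainComplex.of]
  exact ChainComplex.of_d _ _ 0

theorem isZero_twoTermComplex_X (n : ℕ) : IsZero ((twoTermComplex S).X (n + 2)) :=
  isZero_zero C

variable {S}

theorem exactAt_twoTermComplex_succ [Mono S.f] (n : ℕ) : (twoTermComplex S).ExactAt (n + 1) := by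
  rcases n with _ | n
  · rw [HomologicalComplex.exactAt_iff' _ 2 1 0 (by simp) (by simp), ShortComplex.exact_iff_mono]
    · change Mono ((twoTermComplex S).d 1 0)
      rwa [twoTermComplex_d]
    · exact (isZero_twoTermComplex_X S 0).eq_of_src _ _
  · exact .of_isZero (isZero_twoTermComplex_X S n)

/-- A short exact sequence `0 ⟶ X₁ ⟶ X₂ ⟶ X₃ ⟶ 0` with `X₁` and `X₂` projective, viewed as a
projective resolution of `X₃`. -/
noncomputable def twoTermResolution (hS : S.ShortExact) [Projective S.X₁] [Projective S.X₂] :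
    ProjectiveResolution S.X₃ where
  complex := twoTermComplex S
  projective
    | 0 => inferInstanceAs (Projective S.X₂)
    | 1 => inferInstanceAs (Projective S.X₁)
    | n + 2 => (isZero_twoTermComplex_X S n).projective
  π := (ChainComplex.toSingle₀Equiv _ _).symm ⟨S.g, by rw [twoTermComplex_d]; exact S.zero⟩
  quasiIso := ⟨fun n => by
    have := hS.mono_f
    rcases n with _ | n
    · have hπ := ChainComplex.toSingle₀Equiv_symm_apply_f_zero (C := twoTermComplex S) S.g
        (by rw [twoTermComplex_d]; exact S.zero)
      rw [ChainComplex.quasiIsoAt₀_iff, ShortComplex.quasiIso_iff_of_zeros']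
      · refine (ShortComplex.exact_and_epi_g_iff_of_iso (S₂ := S) ?_).2 ⟨hS.exact, hS.epi_g⟩
        exact ShortComplex.isoMk (Iso.refl _) (Iso.refl _) (Iso.refl _)
          ((Category.id_comp _).trans ((twoTermComplex_d S).symm.trans (Category.comp_id _).symm))
          ((Category.id_comp _).trans (hπ.symm.trans (Category.comp_id _).symm))
      all_goals rfl
    · rw [quasiIsoAt_iff_exactAt' _ _ (ChainComplex.exactAt_succ_single_obj _ _)]
      exact exactAt_twoTermComplex_succ n⟩

end TwoTermComplexes

section Homology

universe u

variable {k : Type u} [Field k]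

theorem finite_shortComplex_homology (S : ShortComplex (ModuleCat.{u} k))
    [Module.Finite k S.X₂] : Module.Finite k S.homology :=
  have : Module.Finite k S.moduleCatLeftHomologyData.H :=
    Module.Finite.quotient k (LinearMap.range S.moduleCatToCycles)
  Module.Finite.equiv S.moduleCatHomologyIso.toLinearEquiv.symm

theorem finrank_shortComplex_homology (S : ShortComplex (ModuleCat.{u} k))
    [Module.Finite k S.X₂] :
    (Module.finrank k S.homology : ℤ) = Module.finrank k S.X₂ -
      Module.finrank k (LinearMap.range S.f.hom) - Module.finrank k (LinearMap.range S.g.hom) := by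
  have homology_eq : Module.finrank k S.homology =
      Module.finrank k (LinearMap.ker S.g.hom ⧸ LinearMap.range S.moduleCatToCycles) :=
    S.moduleCatHomologyIso.toLinearEquiv.finrank_eq
  have quotient_eq := Submodule.finrank_quotient_add_finrank (LinearMap.range S.moduleCatToCycles)
  have boundaries_eq : Module.finrank k (LinearMap.range S.moduleCatToCycles) =
      Module.finrank k (LinearMap.range S.f.hom) := by
    rw [← Submodule.finrank_map_subtype_eq (LinearMap.ker S.g.hom), ← LinearMap.range_comp]
    rfl
  have rank_nullity := LinearMap.finrank_range_add_finrank_ker S.g.hom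
  lia

variable (K : CochainComplex (ModuleCat.{u} k) ℕ)

theorem finrank_homology_zero [Module.Finite k (K.X 0)] :
    (Module.finrank k (K.homology 0) : ℤ) =
      Module.finrank k (K.X 0) - Module.finrank k (LinearMap.range (K.d 0 1).hom) := by
  have : Module.Finite k (K.sc' 0 0 1).X₂ := ‹Module.Finite k (K.X 0)›
  have iso := (ShortComplex.homologyMapIso
    (K.isoSc' 0 0 1 (by simp) (by simp))).toLinearEquiv.finrank_eq
  have range_eq : Module.finrank k (LinearMap.range (K.sc' 0 0 1).f.hom) = 0 := by
    rw [show (K.sc' 0 0 1).f = 0 from K.shape 0 0 (by simp)]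
    simp
  have key := finrank_shortComplex_homology (K.sc' 0 0 1)
  rw [range_eq, ← iso, Nat.cast_zero, sub_zero] at key
  exact key

theorem finrank_homology_succ (n : ℕ) [Module.Finite k (K.X (n + 1))] :
    (Module.finrank k (K.homology (n + 1)) : ℤ) = Module.finrank k (K.X (n + 1)) -
      Module.finrank k (LinearMap.range (K.d n (n + 1)).hom) -
        Module.finrank k (LinearMap.range (K.d (n + 1) (n + 2)).hom) := by
  have : Module.Finite k (K.sc' n (n + 1) (n + 2)).X₂ := ‹Module.Finite k (K.X (n + 1))›
  have iso := (ShortComplex.homologyMapIso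
    (K.isoSc' n (n + 1) (n + 2) (by simp) (by simp))).toLinearEquiv.finrank_eq
  have key := finrank_shortComplex_homology (K.sc' n (n + 1) (n + 2))
  rw [← iso] at key
  exact key

end Homology

section CohomologyOfShortExact

universe u

variable {k G : Type u} [Field k] [Group G] {P₁ P₀ : Rep.{u} k G} [Projective P₁] [Projective P₀]
  {f : P₁ ⟶ P₀} {g : P₀ ⟶ Rep.trivial k G k} {w : f ≫ g = 0}

/-- Group cohomology computed by a projective resolution of length one. -/
noncomputable def groupCohomologyEquivOfShortExact (hS : (ShortComplex.mk f g w).ShortExact)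
    (A : Rep.{u} k G) (n : ℕ) :
    groupCohomology A n ≃ₗ[k] ((twoTermComplex (.mk f g w)).linearYonedaObj k A).homology n :=
  have : Projective (ShortComplex.mk f g w).X₁ := ‹Projective P₁›
  have : Projective (ShortComplex.mk f g w).X₂ := ‹Projective P₀›
  (groupCohomologyIso A n (twoTermResolution hS)).toLinearEquiv

theorem isZero_linearYonedaObj_twoTermComplex_X {C : Type*} [Category C] [Abelian C] [Linear k C]
    (S : ShortComplex C) (A : C) (n : ℕ) :
    IsZero (((twoTermComplex S).linearYonedaObj k A).X (n + 2)) :=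
  ModuleCat.isZero_of_iff_subsingleton.2 ⟨(isZero_twoTermComplex_X S n).eq_of_src⟩

theorem subsingleton_groupCohomology_of_shortExact (hS : (ShortComplex.mk f g w).ShortExact)
    (A : Rep.{u} k G) (n : ℕ) : Subsingleton (groupCohomology A (n + 2)) :=
  have := ModuleCat.isZero_iff_subsingleton.1 (HomologicalComplex.ExactAt.of_isZero
    (isZero_linearYonedaObj_twoTermComplex_X (k := k) (.mk f g w) A n)).isZero_homology
  (groupCohomologyEquivOfShortExact hS A (n + 2)).toEquiv.subsingleton

variable (A : Rep.{u} k G) [h₀ : Module.Finite k (P₀ ⟶ A)] [h₁ : Module.Finite k (P₁ ⟶ A)]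

theorem finite_groupCohomology_of_shortExact (hS : (ShortComplex.mk f g w).ShortExact) (n : ℕ) :
    Module.Finite k (groupCohomology A n) := by
  let K := (twoTermComplex (.mk f g w)).linearYonedaObj k A
  have : Module.Finite k (K.sc n).X₂ := match n with
    | 0 => h₀
    | 1 => h₁
    | n + 2 =>
      have := ModuleCat.isZero_iff_subsingleton.1
        (isZero_linearYonedaObj_twoTermComplex_X (k := k) (.mk f g w) A n)
      inferInstanceAs (Module.Finite k (K.X (n + 2)))
  have : Module.Finite k (K.homology n) := finite_shortComplex_homology (K.sc n)
  exact Module.Finite.equiv (groupCohomologyEquivOfShortExact hS A n).symm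

theorem finrank_groupCohomology_zero_sub_one (hS : (ShortComplex.mk f g w).ShortExact) :
    (Module.finrank k (groupCohomology A 0) : ℤ) - Module.finrank k (groupCohomology A 1) =
      Module.finrank k (P₀ ⟶ A) - Module.finrank k (P₁ ⟶ A) := by
  let K := (twoTermComplex (.mk f g w)).linearYonedaObj k A
  have : Module.Finite k (K.X 0) := h₀
  have : Module.Finite k (K.X (0 + 1)) := h₁
  have d_eq : K.d (0 + 1) (0 + 2) = 0 :=
    (isZero_linearYonedaObj_twoTermComplex_X (k := k) (.mk f g w) A 0).eq_of_tgt _ _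
  have H₀ := finrank_homology_zero K
  have H₁ := finrank_homology_succ K 0
  rw [d_eq, ModuleCat.hom_zero, LinearMap.range_zero, finrank_bot] at H₁
  rw [(groupCohomologyEquivOfShortExact hS A 0).finrank_eq,
    (groupCohomologyEquivOfShortExact hS A 1).finrank_eq, H₀, H₁]
  have X₀ : Module.finrank k (K.X 0) = Module.finrank k (P₀ ⟶ A) := rfl
  have X₁ : Module.finrank k (K.X (0 + 1)) = Module.finrank k (P₁ ⟶ A) := rfl
  rw [X₀, X₁, zero_add]
  ring

end CohomologyOfShortExact

theorem hasFiniteCohomology_and_eulerChar_of_subsingleton {G : Type} [Group G] (A : Rep ℚ G)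
    [hfin : ∀ i, Module.Finite ℚ (groupCohomology A i)]
    (hs : ∀ n, Subsingleton (groupCohomology A (n + 2))) :
    HasFiniteCohomology A ∧ homologicalEulerChar A =
      Module.finrank ℚ (groupCohomology A 0) - Module.finrank ℚ (groupCohomology A 1) := by
  have subsingleton_of_le (i : ℕ) (hi : 2 ≤ i) : Subsingleton (groupCohomology A i) := by
    obtain ⟨n, rfl⟩ := Nat.exists_eq_add_of_le' hi
    exact hs n
  refine ⟨⟨hfin, (Set.finite_lt_nat 2).subset fun i hi => ?_⟩, ?_⟩
  · by_contra hlt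
    exact not_nontrivial_iff_subsingleton.2 (subsingleton_of_le i (not_lt.1 hlt)) hi
  · rw [homologicalEulerChar, finsum_eq_sum_of_support_subset (s := Finset.range 2)]
    · simp [Finset.sum_range_succ, sub_eq_add_neg]
    · intro i hi
      rw [Finset.coe_range, Set.mem_Iio]
      by_contra hlt
      have := subsingleton_of_le i (not_lt.1 hlt)
      simp [Module.finrank_zero_of_subsingleton] at hi

section EquivariantGraphs

universe u

variable (k : Type u) {G : Type u} [CommRing k] [Group G] {E V : Type u} [MulAction G E]
  [MulAction G V] (s t : E →[G] V)

/-- The boundary map `k[E] ⟶ k[V]` of the graph with edges `E`, vertices `V`, source map `s` and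
target map `t`. -/
noncomputable def boundary : Rep.ofMulAction k G E ⟶ Rep.ofMulAction k G V :=
  ofMulActionHomEquiv.symm
    ⟨fun e => MonoidAlgebra.single (t e) 1 - MonoidAlgebra.single (s e) 1, fun g e => by
      simp [map_smul]⟩

variable (G V) in
/-- The augmentation `k[V] ⟶ k`. -/
noncomputable def augmentation : Rep.ofMulAction k G V ⟶ Rep.trivial k G k :=
  ofMulActionHomEquiv.symm ⟨fun _ => (1 : k), fun _ _ => rfl⟩

variable {k}

theorem boundary_single (e : E) (r : k) :
    (boundary k s t).hom (MonoidAlgebra.single e r) =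
      MonoidAlgebra.single (t e) r - MonoidAlgebra.single (s e) r := by
  refine (ofMulActionHomEquiv_symm_single _ _ _).trans ?_
  rw [smul_sub, MonoidAlgebra.smul_single, MonoidAlgebra.smul_single, smul_eq_mul, mul_one]

theorem augmentation_single (v : V) (r : k) :
    (augmentation k G V).hom (MonoidAlgebra.single v r) = r :=
  (ofMulActionHomEquiv_symm_single _ _ _).trans (mul_one r)

theorem boundary_comp_augmentation : boundary k s t ≫ augmentation k G V = 0 :=
  ofMulActionHomEquiv.injective <| by
    ext e
    refine (congrArg (augmentation k G V).hom (boundary_single s t e 1)).trans ?_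
    rw [map_sub, augmentation_single, augmentation_single, sub_self]
    rfl

open Classical in
theorem coeff_boundary (x : MonoidAlgebra k E) (v : V) :
    ((boundary k s t).hom x : MonoidAlgebra k V).coeff v =
      x.coeff.sum fun e r => (if t e = v then r else 0) - if s e = v then r else 0 := by
  induction x using MonoidAlgebra.induction_linear with
  | zero => rw [map_zero]; simp
  | add x y hx hy =>
    rw [map_add, MonoidAlgebra.coeff_add, MonoidAlgebra.coeff_add, Finsupp.add_apply, hx, hy,
      Finsupp.sum_add_index' (by simp) (by intros; split_ifs <;> simp [add_comm])]
  | single e r =>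
    rw [boundary_single]
    simp [Finsupp.single_apply]

/-- A function on the edges of a graph such that no edge is a loop and every edge has an end where
it is strictly lower than all other edges. A graph with such a function has no cycles, since a
highest edge of a cycle would meet another edge of the cycle at that end. -/
def IsForestHeight (s t : E → V) (height : E → ℤ) : Prop :=
  ∀ e, s e ≠ t e ∧ ∃ v, (v = s e ∨ v = t e) ∧
    ∀ e', e' ≠ e → (s e' = v ∨ t e' = v) → height e < height e'

variable {s t}

theorem boundary_injective {height : E → ℤ} (h : IsForestHeight s t height) :
    Function.Injective (boundary k s t).hom := by
  classical
  refine (injective_iff_map_eq_zero _).2 fun (x : MonoidAlgebra k E) hx => ?_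
  by_contra hne
  have hsupp : x.coeff.support.Nonempty := by
    rwa [Finsupp.support_nonempty_iff, Ne, MonoidAlgebra.coeff_eq_zero]
  obtain ⟨e, he, hmax⟩ := x.coeff.support.exists_max_image height hsupp
  obtain ⟨hst, v, hv, hlow⟩ := h e
  have coeff_zero := coeff_boundary s t x v
  rw [hx, Finsupp.sum, Finset.sum_eq_single_of_mem e he] at coeff_zero
  · have hxe : x.coeff e ≠ 0 := Finsupp.mem_support_iff.1 he
    rcases hv with rfl | rfl <;> exact hxe (by simpa [hst, hst.symm] using coeff_zero.symm)
  · intro e' he' hne'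
    have : ¬(s e' = v ∨ t e' = v) := fun h' => (hlow e' hne' h').not_ge (hmax e' he')
    rw [not_or] at this
    simp [this]

variable (s t) in
/-- The vertices `v` and `w` are joined by a path, which may traverse edges in both directions. -/
def JoinedByPath : V → V → Prop :=
  Relation.EqvGen fun v w => ∃ e, s e = v ∧ t e = w

theorem single_sub_single_mem_range_boundary {v w : V}
    (h : JoinedByPath s t v w) :
    (MonoidAlgebra.single w 1 - MonoidAlgebra.single v 1 : MonoidAlgebra k V) ∈
      LinearMap.range (boundary k s t).hom.toLinearMap := by
  induction h with
  | rel v w h =>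
    obtain ⟨e, rfl, rfl⟩ := h
    exact ⟨_, boundary_single s t e 1⟩
  | refl v => rw [sub_self]; exact zero_mem _
  | symm v w _ ih => rw [← neg_sub]; exact neg_mem ih
  | trans u v w _ _ ih ih' => rw [← sub_add_sub_cancel]; exact add_mem ih' ih

theorem mem_range_boundary [Nonempty V] (h : ∀ v w, JoinedByPath s t v w) {x : MonoidAlgebra k V}
    (hx : (augmentation k G V).hom x = 0) :
    x ∈ LinearMap.range (boundary k s t).hom.toLinearMap := by
  obtain ⟨v₀⟩ := ‹Nonempty V›
  have key (y : MonoidAlgebra k V) :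
      y - (augmentation k G V).hom y • MonoidAlgebra.single v₀ (1 : k) ∈
        LinearMap.range (boundary k s t).hom.toLinearMap := by
    induction y using MonoidAlgebra.induction_linear with
    | zero => rw [map_zero, zero_smul, sub_zero]; exact zero_mem _
    | add y z hy hz =>
      rw [map_add, add_smul, add_sub_add_comm]
      exact add_mem hy hz
    | single v r =>
      rw [augmentation_single]
      have := Submodule.smul_mem _ r (single_sub_single_mem_range_boundary (k := k) (h v₀ v))
      rwa [smul_sub, MonoidAlgebra.smul_single r v, smul_eq_mul, mul_one] at this
  simpa [hx] using key x

theorem boundary_shortExact [Nonempty V] (hconn : ∀ v w, JoinedByPath s t v w) {height : E → ℤ}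
    (hforest : IsForestHeight s t height) :
    (ShortComplex.mk _ _ (boundary_comp_augmentation (k := k) s t)).ShortExact where
  exact := by
    apply (forget₂ _ (ModuleCat k)).reflects_exact_of_faithful
    rw [ShortComplex.moduleCat_exact_iff]
    exact fun x hx => mem_range_boundary hconn hx
  mono_f := (Rep.mono_iff_injective _).2 (boundary_injective hforest)
  epi_g := (Rep.epi_iff_surjective _).2 fun r =>
    ⟨MonoidAlgebra.single (Classical.arbitrary V) r, augmentation_single _ _⟩

end EquivariantGraphs

theorem hasFiniteCohomology_and_eulerChar_of_tree {G E V : Type} [Group G] [MulAction G E]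
    [MulAction G V] [∀ e : E, Finite (stabilizer G e)] [∀ v : V, Finite (stabilizer G v)]
    [Nonempty V] {s t : E →[G] V} (hconn : ∀ v w, JoinedByPath s t v w) {height : E → ℤ}
    (hforest : IsForestHeight s t height) (M : Rep.{0} ℚ G)
    [Module.Finite ℚ (equivariantMaps E M)] [Module.Finite ℚ (equivariantMaps V M)] :
    HasFiniteCohomology M ∧ homologicalEulerChar M =
      Module.finrank ℚ (equivariantMaps V M) - Module.finrank ℚ (equivariantMaps E M) := by
  have hS := boundary_shortExact (k := ℚ) hconn hforest
  have := Module.Finite.equiv (ofMulActionHomEquiv (X := E) (M := M)).symm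
  have := Module.Finite.equiv (ofMulActionHomEquiv (X := V) (M := M)).symm
  have := finite_groupCohomology_of_shortExact M hS
  obtain ⟨hfin, hχ⟩ := hasFiniteCohomology_and_eulerChar_of_subsingleton M
    (subsingleton_groupCohomology_of_shortExact hS M)
  refine ⟨hfin, ?_⟩
  rw [hχ, finrank_groupCohomology_zero_sub_one M hS, ofMulActionHomEquiv.finrank_eq,
    ofMulActionHomEquiv.finrank_eq]

section CosetGraph

variable {G : Type*} [Group G] {A B C : Subgroup G}

/-- The projection `G ⧸ C → G ⧸ A` for `C ≤ A`. -/
def cosetProj (hA : C ≤ A) : G ⧸ C →[G] G ⧸ A where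
  toFun := Subgroup.quotientMapOfLE hA
  map_smul' g x := by
    induction x using QuotientGroup.induction_on with
    | H x => rfl

/-- The source map of the coset graph of `C ≤ A ⊓ B`, with an edge `gC` joining the vertices `gA`
and `gB` for each coset of `C`. It is the Bass–Serre tree when `G` is the amalgam `A *_C B`. -/
def cosetSource (B : Subgroup G) (hA : C ≤ A) : G ⧸ C →[G] (G ⧸ A) ⊕ (G ⧸ B) where
  toFun e := .inl (cosetProj hA e)
  map_smul' g e := congrArg Sum.inl (map_smul (cosetProj hA) g e)

/-- The target map of the coset graph of `C ≤ A ⊓ B`, see `cosetSource`. -/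
def cosetTarget (A : Subgroup G) (hB : C ≤ B) : G ⧸ C →[G] (G ⧸ A) ⊕ (G ⧸ B) where
  toFun e := .inr (cosetProj hB e)
  map_smul' g e := congrArg Sum.inr (map_smul (cosetProj hB) g e)

theorem exists_eq_mul_of_cosetProj_eq {hA : C ≤ A} {e : G ⧸ C} {g : G}
    (h : cosetProj hA e = cosetProj hA g) : ∃ a ∈ A, e = (g * a : G) := by
  induction e using QuotientGroup.induction_on with
  | H g' => exact ⟨g⁻¹ * g', QuotientGroup.eq.1 h.symm, by rw [mul_inv_cancel_left]⟩

theorem joinedByPath_inl_inr (hA : C ≤ A) (hB : C ≤ B) (g : G) :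
    JoinedByPath (cosetSource B hA) (cosetTarget A hB) (.inl g) (.inr g) :=
  .rel _ _ ⟨(g : G ⧸ C), rfl, rfl⟩

theorem joinedByPath_inl_mul (hA : C ≤ A) (hB : C ≤ B) {h : G} (hh : h ∈ A ⊔ B) (g : G) :
    JoinedByPath (cosetSource B hA) (cosetTarget A hB) (.inl (g * h : G)) (.inl g) := by
  rw [Subgroup.sup_eq_closure] at hh
  induction hh using Subgroup.closure_induction generalizing g with
  | mem h hh =>
    rcases hh with hh | hh
    · rw [QuotientGroup.mk_mul_of_mem g hh]
      exact .refl _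
    · have edge := joinedByPath_inl_inr hA hB (g * h)
      rw [QuotientGroup.mk_mul_of_mem g hh] at edge
      exact edge.trans _ _ _ (joinedByPath_inl_inr hA hB g).symm
  | one => rw [mul_one]; exact .refl _
  | mul a b _ _ ha hb => rw [← mul_assoc]; exact (hb (g * a)).trans _ _ _ (ha g)
  | inv a _ ha =>
    have path := ha (g * a⁻¹)
    rw [inv_mul_cancel_right] at path
    exact path.symm

theorem joinedByPath_coset (hA : C ≤ A) (hB : C ≤ B) (hAB : A ⊔ B = ⊤)
    (v w : (G ⧸ A) ⊕ (G ⧸ B)) : JoinedByPath (cosetSource B hA) (cosetTarget A hB) v w := by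
  have inl_base (g : G) :
      JoinedByPath (cosetSource B hA) (cosetTarget A hB) (.inl g) (.inl (1 : G)) := by
    simpa using joinedByPath_inl_mul hA hB (hAB ▸ Subgroup.mem_top g) 1
  have base (v : (G ⧸ A) ⊕ (G ⧸ B)) :
      JoinedByPath (cosetSource B hA) (cosetTarget A hB) v (.inl (1 : G)) := by
    rcases v with v | v <;> induction v using QuotientGroup.induction_on with | H g => ?_
    · exact inl_base g
    · exact (joinedByPath_inl_inr hA hB g).symm.trans _ _ _ (inl_base g)
  exact (base v).trans _ _ _ (base w).symm

end CosetGraph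

theorem hasFiniteCohomology_and_eulerChar_of_cosetTree {G : Type} [Group G] {A B C : Subgroup G}
    [Finite A] [Finite B] {hA : C ≤ A} {hB : C ≤ B} (hAB : A ⊔ B = ⊤) {height : G ⧸ C → ℤ}
    (hforest : IsForestHeight (cosetSource B hA) (cosetTarget A hB) height) (M : Rep.{0} ℚ G)
    [Module.Finite ℚ M] :
    HasFiniteCohomology M ∧ homologicalEulerChar M =
      Module.finrank ℚ (fixedVectors M A) + Module.finrank ℚ (fixedVectors M B) -
        Module.finrank ℚ (fixedVectors M C) := by
  have : Finite C := Finite.of_injective _ (Subgroup.inclusion_injective hA)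
  let vertexEquiv := (equivariantMapsSumEquiv (G ⧸ A) (G ⧸ B) M).trans
    ((equivariantMapsQuotientEquiv M A).prodCongr (equivariantMapsQuotientEquiv M B))
  let edgeEquiv := equivariantMapsQuotientEquiv M C
  have := Module.Finite.equiv vertexEquiv.symm
  have := Module.Finite.equiv edgeEquiv.symm
  have key := hasFiniteCohomology_and_eulerChar_of_tree (joinedByPath_coset hA hB hAB) hforest M
  rwa [vertexEquiv.finrank_eq, edgeEquiv.finrank_eq, Module.finrank_prod, Nat.cast_add] at key

section DihedralLift

variable {G : Type*} [Group G] {n : ℕ} [NeZero n] {a b : G}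

theorem pow_zmod_val_add (ha : a ^ n = 1) (i j : ZMod n) :
    a ^ (i + j).val = a ^ i.val * a ^ j.val := by
  rw [ZMod.val_add, ← pow_eq_pow_mod _ ha, pow_add]

theorem pow_zmod_val_sub (ha : a ^ n = 1) (i j : ZMod n) :
    a ^ (j - i).val = (a ^ i.val)⁻¹ * a ^ j.val := by
  rw [eq_inv_mul_iff_mul_eq, ← pow_zmod_val_add ha, add_sub_cancel]

theorem pow_mul_of_mul_mul_eq_inv (hb : b * b = 1) (hab : b * a * b = a⁻¹) (i : ℕ) :
    a ^ i * b = b * (a ^ i)⁻¹ := by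
  have hb' : b = b⁻¹ := eq_inv_of_mul_eq_one_left hb
  have hconj : (b * a * b⁻¹) ^ i = (a ^ i)⁻¹ := by rw [← hb', hab, inv_pow]
  rw [← hconj, conj_pow, ← mul_assoc, ← mul_assoc, hb, one_mul, ← hb']

/-- The homomorphism out of the dihedral group sending the rotation `r 1` to `a` and the reflection
`sr 0` to `b`. -/
def dihedralLift (a b : G) (ha : a ^ n = 1) (hb : b * b = 1) (hab : b * a * b = a⁻¹) :
    DihedralGroup n →* G where
  toFun
    | .r i => a ^ i.val
    | .sr i => b * a ^ i.val
  map_one' := by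
    change a ^ (0 : ZMod n).val = 1
    rw [ZMod.val_zero, pow_zero]
  map_mul' := by
    rintro (i | i) (j | j)
    · exact pow_zmod_val_add ha i j
    · change b * a ^ (j - i).val = a ^ i.val * (b * a ^ j.val)
      rw [pow_zmod_val_sub ha, ← mul_assoc, ← mul_assoc, pow_mul_of_mul_mul_eq_inv hb hab]
    · change b * a ^ (i + j).val = b * a ^ i.val * a ^ j.val
      rw [pow_zmod_val_add ha, mul_assoc]
    · change a ^ (j - i).val = b * a ^ i.val * (b * a ^ j.val)
      rw [pow_zmod_val_sub ha, ← mul_assoc, mul_assoc b, pow_mul_of_mul_mul_eq_inv hb hab,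
        ← mul_assoc, hb, one_mul]

end DihedralLift

namespace GLTwoInt

/-- The rotation of order four. -/
def rotFour : GL (Fin 2) ℤ :=
  ⟨!![0, -1; 1, 0], !![0, 1; -1, 0], by decide, by decide⟩

/-- The rotation of order six. -/
def rotSix : GL (Fin 2) ℤ :=
  ⟨!![0, -1; 1, 1], !![1, 1; -1, 0], by decide, by decide⟩

/-- The reflection exchanging the two basis vectors. -/
def swap : GL (Fin 2) ℤ :=
  ⟨!![0, 1; 1, 0], !![0, 1; 1, 0], by decide, by decide⟩

/-- The reflection in the first coordinate axis. -/
def refl : GL (Fin 2) ℤ :=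
  ⟨!![1, 0; 0, -1], !![1, 0; 0, -1], by decide, by decide⟩

/-- The dihedral subgroup of order eight, as the image of a homomorphism. -/
def homFour : DihedralGroup 4 →* GL (Fin 2) ℤ :=
  dihedralLift rotFour swap (by decide) (by decide) (by decide)

/-- The dihedral subgroup of order twelve, as the image of a homomorphism. -/
def homSix : DihedralGroup 6 →* GL (Fin 2) ℤ :=
  dihedralLift rotSix swap (by decide) (by decide) (by decide)

/-- The dihedral subgroup of order four, which is the intersection of the images of `homFour` and
`homSix`. -/
def homTwo : DihedralGroup 2 →* GL (Fin 2) ℤ :=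
  dihedralLift (-1) swap (by decide) (by decide) (by decide)

theorem homTwo_apply_cases (x : DihedralGroup 2) :
    homTwo x = 1 ∨ homTwo x = -1 ∨ homTwo x = swap ∨ homTwo x = -swap := by
  revert x; decide

theorem homFour_apply_cases (x : DihedralGroup 4) :
    (∃ y, homFour x = homTwo y) ∨ ∃ y, homFour x = refl * homTwo y := by
  revert x; decide

theorem homSix_apply_cases (x : DihedralGroup 6) :
    (∃ y, homSix x = homTwo y) ∨ (∃ y, homSix x = rotSix * homTwo y) ∨
      ∃ y, homSix x = rotSix ^ 2 * homTwo y := by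
  revert x; decide

theorem range_homTwo_le_four : homTwo.range ≤ homFour.range := by
  have h : ∀ x, ∃ y, homFour y = homTwo x := by decide
  rintro _ ⟨x, rfl⟩
  exact h x

theorem range_homTwo_le_six : homTwo.range ≤ homSix.range := by
  have h : ∀ x, ∃ y, homSix y = homTwo x := by decide
  rintro _ ⟨x, rfl⟩
  exact h x

/-- The matrices `S` and `T` generate `SL₂(ℤ)`, where `S` is `rotFour` and `S * T` is `rotSix`. -/
theorem mem_of_det_eq_one {H : Subgroup (GL (Fin 2) ℤ)} (h4 : rotFour ∈ H) (h6 : rotSix ∈ H)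
    {g : GL (Fin 2) ℤ} (hg : (g : Matrix (Fin 2) (Fin 2) ℤ).det = 1) : g ∈ H := by
  have hSL : (⊤ : Subgroup (Matrix.SpecialLinearGroup (Fin 2) ℤ)) ≤
      H.comap Matrix.SpecialLinearGroup.toGL := by
    rw [← SpecialLinearGroup.SL2Z_generators, Subgroup.closure_le]
    rintro _ (rfl | rfl)
    · have hS : Matrix.SpecialLinearGroup.toGL ModularGroup.S = rotFour := by
        ext i j; fin_cases i <;> fin_cases j <;> rfl
      exact Subgroup.mem_comap.2 (hS ▸ h4)
    · have hT : Matrix.SpecialLinearGroup.toGL ModularGroup.T = rotFour⁻¹ * rotSix := by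
        ext i j; fin_cases i <;> fin_cases j <;> rfl
      exact Subgroup.mem_comap.2 (hT ▸ H.mul_mem (H.inv_mem h4) h6)
  have hmem : Matrix.SpecialLinearGroup.toGL ⟨g, hg⟩ ∈ H := hSL (Subgroup.mem_top _)
  rwa [show Matrix.SpecialLinearGroup.toGL ⟨g, hg⟩ = g by ext; rfl] at hmem

theorem range_sup_range : homFour.range ⊔ homSix.range = ⊤ := by
  set H := homFour.range ⊔ homSix.range
  have h4 : rotFour ∈ H := le_sup_left (a := homFour.range) ⟨.r 1, by decide⟩
  have h6 : rotSix ∈ H := le_sup_right (b := homSix.range) ⟨.r 1, by decide⟩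
  have hswap : swap ∈ H := le_sup_left (a := homFour.range) ⟨.sr 0, by decide⟩
  refine (Subgroup.eq_top_iff' H).2 fun g => ?_
  rcases Int.isUnit_iff.1 ((Matrix.isUnit_iff_isUnit_det _).1 g.isUnit) with hg | hg
  · exact mem_of_det_eq_one h4 h6 hg
  · have hmul : g * swap ∈ H := mem_of_det_eq_one h4 h6 (by
      rw [Units.val_mul, Matrix.det_mul, hg]; decide)
    exact (H.mul_mem_cancel_right hswap).1 hmul

/-- The inner product of the columns of a matrix. -/
def colInner (g : GL (Fin 2) ℤ) : ℤ := g 0 0 * g 0 1 + g 1 0 * g 1 1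

theorem colInner_mul_homTwo (g : GL (Fin 2) ℤ) (x : DihedralGroup 2) :
    colInner (g * homTwo x) = colInner g := by
  rcases homTwo_apply_cases x with h | h | h | h <;> rw [h] <;>
    simp [colInner, swap, Matrix.mul_apply, Fin.sum_univ_two] <;> ring

theorem colInner_mul_refl (g : GL (Fin 2) ℤ) : colInner (g * refl) = -colInner g := by
  simp [colInner, refl, Matrix.mul_apply, Fin.sum_univ_two]; ring

theorem colInner_mul_rotSix (g : GL (Fin 2) ℤ) :
    colInner (g * rotSix) = g 0 1 ^ 2 + g 1 1 ^ 2 - colInner g := by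
  simp [colInner, rotSix, Matrix.mul_apply, Fin.sum_univ_two]; ring

theorem colInner_mul_rotSix_sq (g : GL (Fin 2) ℤ) :
    colInner (g * rotSix ^ 2) = g 0 0 ^ 2 + g 1 0 ^ 2 - colInner g := by
  simp [colInner, rotSix, pow_two, Matrix.mul_apply, Fin.sum_univ_two]; ring

theorem col_sq_pos (g : GL (Fin 2) ℤ) (j : Fin 2) : 0 < g 0 j ^ 2 + g 1 j ^ 2 := by
  by_contra! h
  have h0 : g 0 j = 0 := by nlinarith [sq_nonneg (g 0 j), sq_nonneg (g 1 j)]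
  have h1 : g 1 j = 0 := by nlinarith [sq_nonneg (g 0 j), sq_nonneg (g 1 j)]
  have hdet : (g : Matrix (Fin 2) (Fin 2) ℤ).det = 0 :=
    Matrix.det_eq_zero_of_column_eq_zero j (Fin.forall_fin_two.2 ⟨h0, h1⟩)
  exact not_isUnit_zero (hdet ▸ (Matrix.isUnit_iff_isUnit_det _).1 g.isUnit)

/-- The height of an edge of the tree of `GL₂(ℤ)`: twice the absolute value of the inner product
`q` of the columns, plus one if `q < 0` so that the edges with inner products `q` and `-q` differ
in height. -/
def height : GL (Fin 2) ℤ ⧸ homTwo.range → ℤ :=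
  Quotient.lift (fun g => if colInner g < 0 then -2 * colInner g + 1 else 2 * colInner g)
    fun a b hab => by
      obtain ⟨x, hx⟩ := QuotientGroup.leftRel_apply.mp hab
      rw [show b = a * homTwo x by rw [hx, mul_inv_cancel_left], colInner_mul_homTwo]

theorem height_mk (g : GL (Fin 2) ℤ) : height (g : GL (Fin 2) ℤ ⧸ homTwo.range) =
    if colInner g < 0 then -2 * colInner g + 1 else 2 * colInner g := rfl

theorem mk_mul_homTwo (g : GL (Fin 2) ℤ) (x : DihedralGroup 2) :
    ((g * homTwo x : GL (Fin 2) ℤ) : GL (Fin 2) ℤ ⧸ homTwo.range) = g :=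
  QuotientGroup.mk_mul_of_mem g ⟨x, rfl⟩

theorem height_lt_of_colInner_pos {g : GL (Fin 2) ℤ} (hg : 0 < colInner g)
    {e : GL (Fin 2) ℤ ⧸ homTwo.range} (hne : e ≠ g)
    (he : cosetProj range_homTwo_le_four e = cosetProj range_homTwo_le_four g) :
    height g < height e := by
  obtain ⟨_, ⟨x, rfl⟩, rfl⟩ := exists_eq_mul_of_cosetProj_eq he
  rcases homFour_apply_cases x with ⟨y, hy⟩ | ⟨y, hy⟩
  · exact absurd (by rw [hy, mk_mul_homTwo]) hne
  · rw [hy, ← mul_assoc, mk_mul_homTwo, height_mk, height_mk, colInner_mul_refl,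
      if_neg (by lia), if_pos (by lia)]
    lia

/-- Reduction of binary quadratic forms: when `q ≤ 0`, the two other edges at the same vertex have
inner products `c - q`, where `c > 0` is the squared length of a column. -/
theorem height_lt_of_colInner_nonpos {g : GL (Fin 2) ℤ} (hg : colInner g ≤ 0)
    {e : GL (Fin 2) ℤ ⧸ homTwo.range} (hne : e ≠ g)
    (he : cosetProj range_homTwo_le_six e = cosetProj range_homTwo_le_six g) :
    height g < height e := by
  obtain ⟨_, ⟨x, rfl⟩, rfl⟩ := exists_eq_mul_of_cosetProj_eq he
  have h0 := col_sq_pos g 0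
  have h1 := col_sq_pos g 1
  rcases homSix_apply_cases x with ⟨y, hy⟩ | ⟨y, hy⟩ | ⟨y, hy⟩
  · exact absurd (by rw [hy, mk_mul_homTwo]) hne
  · rw [hy, ← mul_assoc, mk_mul_homTwo, height_mk, height_mk, colInner_mul_rotSix,
      if_neg (by lia : ¬g 0 1 ^ 2 + g 1 1 ^ 2 - colInner g < 0)]
    split_ifs <;> lia
  · rw [hy, ← mul_assoc, mk_mul_homTwo, height_mk, height_mk, colInner_mul_rotSix_sq,
      if_neg (by lia : ¬g 0 0 ^ 2 + g 1 0 ^ 2 - colInner g < 0)]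
    split_ifs <;> lia

theorem isForestHeight_height : IsForestHeight (cosetSource homSix.range range_homTwo_le_four)
    (cosetTarget homFour.range range_homTwo_le_six) height := by
  intro e
  refine ⟨Sum.inl_ne_inr, ?_⟩
  induction e using QuotientGroup.induction_on with | H g => ?_
  rcases lt_or_ge 0 (colInner g) with hg | hg
  · refine ⟨_, .inl rfl, fun e' hne he' => height_lt_of_colInner_pos hg hne ?_⟩
    exact Sum.inl_injective (he'.resolve_right Sum.inr_ne_inl)
  · refine ⟨_, .inr rfl, fun e' hne he' => height_lt_of_colInner_nonpos hg hne ?_⟩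
    exact Sum.inr_injective (he'.resolve_left Sum.inl_ne_inr)

theorem hasFiniteCohomology_and_eulerChar (M : Rep.{0} ℚ (GL (Fin 2) ℤ)) [Module.Finite ℚ M] :
    HasFiniteCohomology M ∧ homologicalEulerChar M =
      Module.finrank ℚ (fixedVectors M homFour.range) +
        Module.finrank ℚ (fixedVectors M homSix.range) -
          Module.finrank ℚ (fixedVectors M homTwo.range) :=
  hasFiniteCohomology_and_eulerChar_of_cosetTree range_sup_range isForestHeight_height M

end GLTwoInt

section SymPowTrace

variable {R : Type*} [CommRing R]

/-- The complete homogeneous symmetric polynomial of degree `m` in two variables with sum `t` and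
product `d`. -/
def symPowTrace (t d : R) : ℕ → R
  | 0 => 1
  | 1 => t
  | m + 2 => t * symPowTrace t d (m + 1) - d * symPowTrace t d m

theorem symPowTrace_add_two (t d : R) (m : ℕ) :
    symPowTrace t d (m + 2) = t * symPowTrace t d (m + 1) - d * symPowTrace t d m := by
  rw [symPowTrace]

theorem symPowTrace_neg (t d : R) (m : ℕ) :
    symPowTrace (-t) d m = (-1) ^ m * symPowTrace t d m := by
  induction m using Nat.twoStepInduction with
  | zero => simp [symPowTrace]
  | one => simp [symPowTrace]
  | more m ih₀ ih₁ => rw [symPowTrace_add_two, symPowTrace_add_two, ih₀, ih₁]; ring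

theorem symPowTrace_two_one (m : ℕ) : symPowTrace (2 : R) 1 m = m + 1 := by
  induction m using Nat.twoStepInduction with
  | zero => simp [symPowTrace]
  | one => simp [symPowTrace, one_add_one_eq_two]
  | more m ih₀ ih₁ => rw [symPowTrace_add_two, ih₀, ih₁]; push_cast; ring

theorem symPowTrace_zero_of_odd (d : R) {m : ℕ} (hm : Odd m) : symPowTrace 0 d m = 0 := by
  obtain ⟨j, rfl⟩ := hm
  induction j with
  | zero => rfl
  | succ j ih => simp [Nat.mul_succ, add_right_comm _ _ 1, symPowTrace_add_two, ih]

theorem symPowTrace_zero_neg_one_of_even {m : ℕ} (hm : Even m) :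
    symPowTrace (0 : R) (-1) m = 1 := by
  obtain ⟨j, rfl⟩ := even_iff_exists_two_mul.1 hm
  induction j with
  | zero => rfl
  | succ j ih => rw [Nat.mul_succ, symPowTrace_add_two, ih (even_two_mul j)]; ring

theorem symPowTrace_zero_one_add_four (m : ℕ) :
    symPowTrace (0 : R) 1 (m + 4) = symPowTrace 0 1 m := by
  simp only [symPowTrace_add_two]; ring

theorem symPowTrace_one_one_add_six (m : ℕ) :
    symPowTrace (1 : R) 1 (m + 6) = symPowTrace 1 1 m := by
  simp only [symPowTrace_add_two]; ring

end SymPowTrace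

section DiagonalCoefficients

open Polynomial Finset

variable {R : Type*} [CommRing R]

theorem coeff_linear_mul (a c : R) (p : R[X]) (i : ℕ) :
    ((C a * X + C c) * p).coeff (i + 1) = a * p.coeff i + c * p.coeff (i + 1) := by
  rw [add_mul, mul_assoc, coeff_add, coeff_C_mul, coeff_C_mul, coeff_X_mul]

variable (a b c d : R)

theorem sum_coeff_succ (m : ℕ) :
    ∑ p ∈ antidiagonal (m + 1), ((C a * X + C c) ^ p.1 * (C b * X + C d) ^ p.2).coeff p.1 =
      d ^ (m + 1) +
        (a * ∑ p ∈ antidiagonal m, ((C a * X + C c) ^ p.1 * (C b * X + C d) ^ p.2).coeff p.1 +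
        c * ∑ p ∈ antidiagonal m,
          ((C a * X + C c) ^ p.1 * (C b * X + C d) ^ p.2).coeff (p.1 + 1)) := by
  rw [Nat.sum_antidiagonal_succ, mul_sum, mul_sum, ← sum_add_distrib]
  refine congrArg₂ _ ?_ (sum_congr rfl fun p _ => ?_)
  · simp [coeff_zero_eq_eval_zero]
  · rw [pow_succ', mul_assoc, coeff_linear_mul]

theorem sum_coeff_add_one_succ (m : ℕ) :
    ∑ p ∈ antidiagonal (m + 1), ((C a * X + C c) ^ p.1 * (C b * X + C d) ^ p.2).coeff (p.1 + 1) =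
      b * ∑ p ∈ antidiagonal m, ((C a * X + C c) ^ p.1 * (C b * X + C d) ^ p.2).coeff p.1 +
        d * ∑ p ∈ antidiagonal m,
          ((C a * X + C c) ^ p.1 * (C b * X + C d) ^ p.2).coeff (p.1 + 1) := by
  have hdeg : ((C a * X + C c) ^ (m + 1)).natDegree < m + 1 + 1 :=
    Nat.lt_succ_of_le ((natDegree_pow_le_of_le _ natDegree_linear_le).trans_eq (mul_one _))
  rw [Nat.sum_antidiagonal_succ', pow_zero, mul_one, coeff_eq_zero_of_natDegree_lt hdeg, zero_add,
    mul_sum, mul_sum, ← sum_add_distrib]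
  refine sum_congr rfl fun p _ => ?_
  rw [pow_succ', mul_left_comm, coeff_linear_mul]

theorem sum_coeff_eq_symPowTrace (m : ℕ) :
    ∑ p ∈ antidiagonal m, ((C a * X + C c) ^ p.1 * (C b * X + C d) ^ p.2).coeff p.1 =
      symPowTrace (a + d) (a * d - b * c) m := by
  induction m using Nat.twoStepInduction with
  | zero => simp [symPowTrace]
  | one => simp [symPowTrace, Nat.antidiagonal_succ, add_comm]
  | more m ih₀ ih₁ =>
    have h := sum_coeff_succ a b c d m
    rw [symPowTrace_add_two, ← ih₀, ← ih₁, sum_coeff_succ, sum_coeff_add_one_succ]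
    linear_combination -d * h

end DiagonalCoefficients

section SymmetricPowerTrace

open Polynomial Finset

variable {R : Type} [CommRing R]

/-- The linear map out of `Symⁿ V` induced by a symmetric multilinear map. -/
noncomputable def symPowLift {V W : Type} [AddCommGroup V] [Module R V] [AddCommGroup W]
    [Module R W] {n : ℕ} (f : MultilinearMap R (fun _ : Fin n => V) W)
    (hf : ∀ (e : Equiv.Perm (Fin n)) (v : Fin n → V), f (fun i => v (e i)) = f v) :
    SymmetricPower R (Fin n) V →ₗ[R] W where
  __ := AddCon.lift (addConGen (SymmetricPower.Rel R (Fin n) V))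
    (PiTensorProduct.lift f).toAddMonoidHom
    (by
      refine AddCon.addConGen_le.2 ?_
      intro x y h
      cases h with
      | perm e g =>
        simp only [AddCon.ker_rel, LinearMap.toAddMonoidHom_coe, PiTensorProduct.lift.tprod]
        exact (hf e g).symm)
  map_smul' r x := by
    induction x using AddCon.induction_on with
    | H x => exact (PiTensorProduct.lift f).map_smul r x

theorem symPowLift_tprod {V W : Type} [AddCommGroup V] [Module R V] [AddCommGroup W]
    [Module R W] {n : ℕ} (f : MultilinearMap R (fun _ : Fin n => V) W)
    (hf : ∀ (e : Equiv.Perm (Fin n)) (v : Fin n → V), f (fun i => v (e i)) = f v)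
    (v : Fin n → V) : symPowLift f hf (SymmetricPower.tprod R v) = f v :=
  PiTensorProduct.lift.tprod v

/-- The linear polynomial `v₀ X + v₁`. -/
noncomputable def linearPoly : (Fin 2 → R) →ₗ[R] R[X] :=
  LinearMap.toSpanSingleton R R[X] X ∘ₗ LinearMap.proj 0 +
    LinearMap.toSpanSingleton R R[X] 1 ∘ₗ LinearMap.proj 1

theorem linearPoly_apply (v : Fin 2 → R) : linearPoly v = C (v 0) * X + C (v 1) := by
  simp [linearPoly, smul_eq_C_mul]

/-- The identification of `Symᵐ R²` with the polynomials of degree at most `m`, sending `v₁ ⋯ vₘ`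
to the product of the linear polynomials of the `vᵢ`. -/
noncomputable def symPowToPoly (m : ℕ) : SymmetricPower R (Fin m) (Fin 2 → R) →ₗ[R] R[X] :=
  symPowLift ((MultilinearMap.mkPiAlgebra R (Fin m) R[X]).compLinearMap fun _ => linearPoly)
    fun e v => by
      simpa using Equiv.prod_comp e fun i => linearPoly (v i)

theorem symPowToPoly_tprod {m : ℕ} (v : Fin m → Fin 2 → R) :
    symPowToPoly m (SymmetricPower.tprod R v) = ∏ i, linearPoly (v i) := by
  rw [symPowToPoly, symPowLift_tprod]
  simp

theorem prod_ite_val_lt {M : Type*} [CommMonoid M] {m k : ℕ} (hk : k ≤ m) (p q : M) :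
    (∏ i : Fin m, if i.val < k then p else q) = p ^ k * q ^ (m - k) := by
  rw [Fin.prod_univ_eq_prod_range (fun i => if i < k then p else q) m,
    ← prod_range_mul_prod_Ico _ hk,
    prod_congr rfl fun i hi => if_pos (mem_range.1 hi),
    prod_congr rfl fun i hi => if_neg (not_lt.2 (mem_Ico.1 hi).1)]
  simp

theorem exists_eq_ite_of_monotone {m : ℕ} (g : Fin m → Fin 2) (hg : Monotone g) :
    ∃ k ≤ m, ∀ i, g i = if i.val < k then 0 else 1 := by
  classical
  have hex : ∃ k, ∀ i : Fin m, k ≤ i.val → g i = 1 := ⟨m, fun i hi => absurd i.2 (not_lt.2 hi)⟩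
  refine ⟨Nat.find hex, Nat.find_min' hex fun i hi => absurd i.2 (not_lt.2 hi), fun i => ?_⟩
  split_ifs with h
  · by_contra hi
    refine Nat.find_min hex h fun j hj => ?_
    have := hg (show i ≤ j from hj)
    lia
  · exact Nat.find_spec hex i (not_lt.1 h)

variable (R) in
/-- The product `e₀ᵏ e₁ᵐ⁻ᵏ` in `Symᵐ R²`. -/
noncomputable def symPowMonomial (m k : ℕ) : SymmetricPower R (Fin m) (Fin 2 → R) :=
  SymmetricPower.tprod R fun i => if i.val < k then Pi.single 0 1 else Pi.single 1 1

theorem symPowToPoly_map_symPowMonomial {m k : ℕ} (hk : k ≤ m)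
    (f : (Fin 2 → R) →ₗ[R] (Fin 2 → R)) :
    symPowToPoly m (SymmetricPower.map m f (symPowMonomial R m k)) =
      linearPoly (f (Pi.single 0 1)) ^ k * linearPoly (f (Pi.single 1 1)) ^ (m - k) := by
  rw [symPowMonomial, SymmetricPower.map_tprod, symPowToPoly_tprod, ← prod_ite_val_lt hk]
  exact prod_congr rfl fun i _ => by split_ifs <;> rfl

theorem symPowToPoly_symPowMonomial {m k : ℕ} (hk : k ≤ m) :
    symPowToPoly m (symPowMonomial R m k) = X ^ k := by
  have h := prod_ite_val_lt hk (X : R[X]) 1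
  rw [one_pow, mul_one] at h
  rw [symPowMonomial, symPowToPoly_tprod, ← h]
  exact prod_congr rfl fun i _ => by split_ifs <;> simp [linearPoly_apply]

theorem span_symPowMonomial (m : ℕ) :
    ⊤ ≤ Submodule.span R (Set.range fun k : Fin (m + 1) => symPowMonomial R m k) := by
  rw [← SymmetricPower.span_tprod_eq_top, Submodule.span_le]
  rintro _ ⟨v, rfl⟩
  have hv : v = fun i => ∑ j : Fin 2, v i j • (Pi.single j 1 : Fin 2 → R) := by
    ext i j
    fin_cases j <;> simp
  rw [hv, MultilinearMap.map_sum]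
  refine Submodule.sum_mem _ fun r _ => ?_
  rw [MultilinearMap.map_smul_univ]
  refine Submodule.smul_mem _ _ ?_
  rw [← SymmetricPower.tprod_equiv (Tuple.sort r)]
  obtain ⟨k, hk, h⟩ := exists_eq_ite_of_monotone _ (Tuple.monotone_sort r)
  refine Submodule.subset_span ⟨⟨k, Nat.lt_succ_of_le hk⟩, ?_⟩
  refine congrArg (SymmetricPower.tprod R) (funext fun i => ?_)
  have hi : r (Tuple.sort r i) = _ := h i
  rw [hi]
  split_ifs <;> rfl

theorem linearIndependent_symPowMonomial (m : ℕ) :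
    LinearIndependent R fun k : Fin (m + 1) => symPowMonomial R m k := by
  refine LinearIndependent.of_comp (symPowToPoly m) ?_
  have h : (symPowToPoly m ∘ fun k : Fin (m + 1) => symPowMonomial R m k) =
      basisMonomials R ∘ Fin.val :=
    funext fun k => by
      simp [symPowToPoly_symPowMonomial (Nat.lt_succ_iff.1 k.2), X_pow_eq_monomial]
  rw [h]
  exact (basisMonomials R).linearIndependent.comp _ Fin.val_injective

variable (R) in
/-- The monomial basis of `Symᵐ R²`. -/
noncomputable def symPowBasis (m : ℕ) :
    Module.Basis (Fin (m + 1)) R (SymmetricPower R (Fin m) (Fin 2 → R)) :=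
  Module.Basis.mk (linearIndependent_symPowMonomial m) (span_symPowMonomial m)

instance finite_symmetricPower_plane (m : ℕ) :
    Module.Finite R (SymmetricPower R (Fin m) (Fin 2 → R)) :=
  Module.Finite.of_basis (symPowBasis R m)

theorem symPowBasis_repr (m : ℕ) (x : SymmetricPower R (Fin m) (Fin 2 → R)) (k : Fin (m + 1)) :
    (symPowBasis R m).repr x k = (symPowToPoly m x).coeff k := by
  have h : (symPowBasis R m).coord k = lcoeff R k ∘ₗ symPowToPoly m :=
    (symPowBasis R m).ext fun j => by
      rw [Module.Basis.coord_apply, Module.Basis.repr_self, LinearMap.comp_apply, symPowBasis,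
        Module.Basis.mk_apply, symPowToPoly_symPowMonomial (Nat.lt_succ_iff.1 j.2), lcoeff_apply,
        coeff_X_pow, Finsupp.single_apply]
      simp [Fin.ext_iff, eq_comm]
  exact LinearMap.congr_fun h x

theorem trace_symPow_eq_sum_coeff (m : ℕ) (f : (Fin 2 → R) →ₗ[R] (Fin 2 → R)) :
    LinearMap.trace R _ (SymmetricPower.map m f) = ∑ p ∈ antidiagonal m,
      (linearPoly (f (Pi.single 0 1)) ^ p.1 * linearPoly (f (Pi.single 1 1)) ^ p.2).coeff p.1 := by
  rw [LinearMap.trace_eq_matrix_trace R (symPowBasis R m), Matrix.trace,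
    Nat.sum_antidiagonal_eq_sum_range_succ_mk, sum_range]
  refine sum_congr rfl fun k _ => ?_
  rw [Matrix.diag_apply, LinearMap.toMatrix_apply, symPowBasis_repr, symPowBasis,
    Module.Basis.mk_apply, symPowToPoly_map_symPowMonomial (Nat.lt_succ_iff.1 k.2)]

theorem trace_symPow_toLin' (m : ℕ) (A : Matrix (Fin 2) (Fin 2) R) :
    LinearMap.trace R _ (SymmetricPower.map m (Matrix.toLin' A)) =
      symPowTrace A.trace A.det m := by
  rw [trace_symPow_eq_sum_coeff, Matrix.trace_fin_two, Matrix.det_fin_two,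
    ← sum_coeff_eq_symPowTrace]
  simp [linearPoly_apply]

end SymmetricPowerTrace

section Averages

universe u

theorem card_mul_finrank_fixedVectors {k G : Type u} {K : Type*} [Field k] [CharZero k] [Group G]
    [Group K] [Fintype K] (M : Rep.{u} k G) [Module.Finite k M] (φ : K →* G) :
    (Nat.card K : k) * Module.finrank k (fixedVectors M φ.range) =
      ∑ x, M.ρ.character (φ x) := by
  have hcard : (Nat.card K : k) ≠ 0 := Nat.cast_ne_zero.2 Nat.card_pos.ne'
  let := invertibleOfNonzero hcard
  have hfixed : fixedVectors M φ.range = Representation.invariants (M.ρ.comp φ) := by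
    ext v
    simp [mem_fixedVectors]
  rw [hfixed, ← Representation.card_inv_mul_sum_char_eq_finrank, mul_inv_cancel_left₀ hcard]
  rfl

theorem sum_dihedralGroup {n : ℕ} [NeZero n] {M : Type*} [AddCommMonoid M]
    (f : DihedralGroup n → M) : ∑ x, f x = (∑ i, f (.r i)) + ∑ i, f (.sr i) := by
  rw [← DihedralGroup.equivSum.symm.sum_comp, Fintype.sum_sum_type]
  rfl

end Averages

namespace GLTwoInt

section ClassFunctions

variable {R : Type*} [CommSemiring R] {χ : GL (Fin 2) ℤ → R}

theorem sum_homTwo (hχ : ∀ g h, χ (h * g * h⁻¹) = χ g) :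
    ∑ x, χ (homTwo x) = χ 1 + χ (-1) + 2 * χ swap := by
  have hsum (f : ZMod 2 → R) : ∑ i, f i = f 0 + f 1 := Fin.sum_univ_two f
  rw [sum_dihedralGroup, hsum, hsum]
  rw [show homTwo (.r 0) = 1 by decide, show homTwo (.r 1) = -1 by decide,
    show homTwo (.sr 0) = swap by decide,
    show homTwo (.sr 1) = rotFour * swap * rotFour⁻¹ by decide]
  simp only [hχ]
  ring

theorem sum_homFour (hχ : ∀ g h, χ (h * g * h⁻¹) = χ g) :
    ∑ x, χ (homFour x) = χ 1 + χ (-1) + 2 * χ rotFour + 2 * χ swap + 2 * χ refl := by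
  have hsum (f : ZMod 4 → R) : ∑ i, f i = f 0 + f 1 + f 2 + f 3 := Fin.sum_univ_four f
  rw [sum_dihedralGroup, hsum, hsum]
  rw [show homFour (.r 0) = 1 by decide, show homFour (.r 1) = rotFour by decide,
    show homFour (.r 2) = -1 by decide, show homFour (.r 3) = swap * rotFour * swap⁻¹ by decide,
    show homFour (.sr 0) = swap by decide, show homFour (.sr 1) = refl by decide,
    show homFour (.sr 2) = rotFour * swap * rotFour⁻¹ by decide,
    show homFour (.sr 3) = rotFour * refl * rotFour⁻¹ by decide]
  simp only [hχ]
  ring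

theorem sum_homSix (hχ : ∀ g h, χ (h * g * h⁻¹) = χ g) :
    ∑ x, χ (homSix x) =
      χ 1 + χ (-1) + 2 * χ rotSix + 2 * χ (-rotSix) + 6 * χ swap := by
  have hsum (f : ZMod 6 → R) : ∑ i, f i = f 0 + f 1 + f 2 + f 3 + f 4 + f 5 :=
    Fin.sum_univ_six f
  rw [sum_dihedralGroup, hsum, hsum]
  rw [show homSix (.r 0) = 1 by decide, show homSix (.r 1) = rotSix by decide,
    show homSix (.r 2) = swap * -rotSix * swap⁻¹ by decide,
    show homSix (.r 3) = -1 by decide, show homSix (.r 4) = -rotSix by decide,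
    show homSix (.r 5) = swap * rotSix * swap⁻¹ by decide,
    show homSix (.sr 0) = swap by decide,
    show homSix (.sr 1) = rotSix * rotFour * swap * (rotSix * rotFour)⁻¹ by decide,
    show homSix (.sr 2) = rotSix⁻¹ * swap * rotSix⁻¹⁻¹ by decide,
    show homSix (.sr 3) = rotFour * swap * rotFour⁻¹ by decide,
    show homSix (.sr 4) = rotSix * swap * rotSix⁻¹ by decide,
    show homSix (.sr 5) = rotSix⁻¹ * rotFour * swap * (rotSix⁻¹ * rotFour)⁻¹ by decide]
  simp only [hχ]
  ring

end ClassFunctions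

theorem eulerChar_eq_character (M : Rep.{0} ℚ (GL (Fin 2) ℤ)) [Module.Finite ℚ M] :
    (homologicalEulerChar M : ℚ) = -(M.ρ.character 1 + M.ρ.character (-1)) / 24 +
      M.ρ.character rotFour / 4 + (M.ρ.character rotSix + M.ρ.character (-rotSix)) / 6 +
        (M.ρ.character swap + M.ρ.character refl) / 4 := by
  have h2 := card_mul_finrank_fixedVectors M homTwo
  have h4 := card_mul_finrank_fixedVectors M homFour
  have h6 := card_mul_finrank_fixedVectors M homSix
  rw [DihedralGroup.nat_card] at h2 h4 h6
  rw [sum_homTwo M.ρ.char_conj] at h2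
  rw [sum_homFour M.ρ.char_conj] at h4
  rw [sum_homSix M.ρ.char_conj] at h6
  rw [(hasFiniteCohomology_and_eulerChar M).2]
  push_cast at h2 h4 h6 ⊢
  linarith

instance finite_symV (m : ℕ) : Module.Finite ℚ (symV m) :=
  inferInstanceAs (Module.Finite ℚ (SymmetricPower ℚ (Fin m) (Fin 2 → ℚ)))

instance finite_symVDet (m : ℕ) : Module.Finite ℚ (symVDet m) :=
  inferInstanceAs (Module.Finite ℚ (SymmetricPower ℚ (Fin m) (Fin 2 → ℚ) ⊗[ℚ] ℚ))

theorem character_symV (m : ℕ) (g : GL (Fin 2) ℤ) {t d : ℤ}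
    (ht : (g : Matrix (Fin 2) (Fin 2) ℤ).trace = t)
    (hd : (g : Matrix (Fin 2) (Fin 2) ℤ).det = d) :
    (symV m).ρ.character g = symPowTrace (t : ℚ) d m := by
  refine (trace_symPow_toLin' m _).trans ?_
  rw [← ht, ← hd, Matrix.trace_fin_two, Matrix.det_fin_two, Matrix.trace_fin_two,
    Matrix.det_fin_two]
  push_cast
  rfl

theorem character_symV_neg (m : ℕ) (g : GL (Fin 2) ℤ) :
    (symV m).ρ.character (-g) = (-1) ^ m * (symV m).ρ.character g := by
  rw [character_symV m g rfl rfl, ← symPowTrace_neg, ← Int.cast_neg]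
  exact character_symV m (-g) (by simp) (by simp [Matrix.det_neg])

theorem character_symV_one (m : ℕ) : (symV m).ρ.character 1 = m + 1 := by
  rw [← symPowTrace_two_one]
  exact_mod_cast character_symV m 1 (t := 2) (d := 1) (by decide) (by decide)

theorem character_symV_rotFour (m : ℕ) : (symV m).ρ.character rotFour = symPowTrace 0 1 m := by
  exact_mod_cast character_symV m rotFour (t := 0) (d := 1) (by decide) (by decide)

theorem character_symV_rotSix (m : ℕ) : (symV m).ρ.character rotSix = symPowTrace 1 1 m := by
  exact_mod_cast character_symV m rotSix (t := 1) (d := 1) (by decide) (by decide)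

theorem character_symV_swap (m : ℕ) : (symV m).ρ.character swap = symPowTrace 0 (-1) m := by
  exact_mod_cast character_symV m swap (t := 0) (d := -1) (by decide) (by decide)

theorem character_symV_refl (m : ℕ) : (symV m).ρ.character refl = symPowTrace 0 (-1) m := by
  exact_mod_cast character_symV m refl (t := 0) (d := -1) (by decide) (by decide)

theorem eulerChar_symV (m : ℕ) : (homologicalEulerChar (symV m) : ℚ) =
    (1 + (-1) ^ m) * (symPowTrace 1 1 m / 6 - (m + 1) / 24) + symPowTrace 0 1 m / 4 +
      symPowTrace 0 (-1) m / 2 := by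
  rw [eulerChar_eq_character, character_symV_neg, character_symV_neg, character_symV_one,
    character_symV_rotFour, character_symV_rotSix, character_symV_swap, character_symV_refl]
  ring

theorem eulerChar_symV_of_odd {m : ℕ} (hm : Odd m) : homologicalEulerChar (symV m) = 0 := by
  have h := eulerChar_symV m
  rw [hm.neg_one_pow, symPowTrace_zero_of_odd _ hm, symPowTrace_zero_of_odd _ hm] at h
  rw [← Int.cast_inj (α := ℚ), h]
  norm_num

theorem eulerChar_symV_of_even {m : ℕ} (hm : Even m) : (homologicalEulerChar (symV m) : ℚ) =
    symPowTrace 1 1 m / 3 + symPowTrace 0 1 m / 4 - (m + 1) / 12 + 1 / 2 := by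
  rw [eulerChar_symV, hm.neg_one_pow, symPowTrace_zero_neg_one_of_even hm]
  ring

theorem eulerChar_symV_add_twelve {m : ℕ} (hm : Even m) :
    homologicalEulerChar (symV (m + 12)) = homologicalEulerChar (symV m) - 1 := by
  have h3 : symPowTrace (1 : ℚ) 1 (m + 12) = symPowTrace 1 1 m := by
    rw [symPowTrace_one_one_add_six (m + 6), symPowTrace_one_one_add_six]
  have h2 : symPowTrace (0 : ℚ) 1 (m + 12) = symPowTrace 0 1 m := by
    rw [symPowTrace_zero_one_add_four (m + 8), symPowTrace_zero_one_add_four (m + 4),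
      symPowTrace_zero_one_add_four]
  rw [← Int.cast_inj (α := ℚ), Int.cast_sub, eulerChar_symV_of_even hm,
    eulerChar_symV_of_even (hm.add (by decide)), h2, h3]
  push_cast
  ring

theorem eulerChar_symV_mul_add (n : ℕ) {k : ℕ} (hk : Even k) :
    homologicalEulerChar (symV (12 * n + k)) = homologicalEulerChar (symV k) - n := by
  induction n with
  | zero => simp
  | succ n ih =>
    rw [show 12 * (n + 1) + k = 12 * n + k + 12 by ring,
      eulerChar_symV_add_twelve (((by decide : Even 12).mul_right n).add hk), ih]
    push_cast
    ring

theorem eulerChar_symV_small :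
    homologicalEulerChar (symV 0) = 1 ∧ homologicalEulerChar (symV 2) = 0 ∧
      homologicalEulerChar (symV 4) = 0 ∧ homologicalEulerChar (symV 6) = 0 ∧
        homologicalEulerChar (symV 8) = 0 ∧ homologicalEulerChar (symV 10) = -1 := by
  refine ⟨?_, ?_, ?_, ?_, ?_, ?_⟩ <;>
  · rw [← Int.cast_inj (α := ℚ), eulerChar_symV_of_even (by decide)]
    norm_num [symPowTrace]

theorem character_detRep (g : GL (Fin 2) ℤ) :
    detRep.character g = ((g : Matrix (Fin 2) (Fin 2) ℤ).det : ℚ) := by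
  simp [Representation.character, detRep]

theorem character_symVDet (m : ℕ) (g : GL (Fin 2) ℤ) {d : ℤ}
    (hd : (g : Matrix (Fin 2) (Fin 2) ℤ).det = d) :
    (symVDet m).ρ.character g = (symV m).ρ.character g * d := by
  rw [← hd, ← character_detRep]
  exact congrFun (Representation.char_tensor (symV m).ρ detRep) g

/-- Twisting by `det` changes the sign of the contributions of the two classes of reflections. -/
theorem eulerChar_symVDet (m : ℕ) : (homologicalEulerChar (symVDet m) : ℚ) =
    homologicalEulerChar (symV m) - symPowTrace 0 (-1) m := by
  rw [eulerChar_eq_character, eulerChar_eq_character,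
    character_symVDet m 1 (d := 1) (by decide), character_symVDet m (-1) (d := 1) (by decide),
    character_symVDet m rotFour (d := 1) (by decide),
    character_symVDet m rotSix (d := 1) (by decide),
    character_symVDet m (-rotSix) (d := 1) (by decide),
    character_symVDet m swap (d := -1) (by decide),
    character_symVDet m refl (d := -1) (by decide), character_symV_swap, character_symV_refl]
  push_cast
  ring

theorem eulerChar_symVDet_of_odd {m : ℕ} (hm : Odd m) : homologicalEulerChar (symVDet m) = 0 := by
  have h := eulerChar_symVDet m
  rw [eulerChar_symV_of_odd hm, symPowTrace_zero_of_odd _ hm] at h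
  exact_mod_cast h

theorem eulerChar_symVDet_of_even {m : ℕ} (hm : Even m) :
    homologicalEulerChar (symVDet m) = homologicalEulerChar (symV m) - 1 := by
  have h := eulerChar_symVDet m
  rw [symPowTrace_zero_neg_one_of_even hm] at h
  exact_mod_cast h

theorem eulerChar_symVDet_mul_add (n : ℕ) {k : ℕ} (hk : Even k) :
    homologicalEulerChar (symVDet (12 * n + k)) = homologicalEulerChar (symV k) - n - 1 := by
  rw [eulerChar_symVDet_of_even (((by decide : Even 12).mul_right n).add hk),
    eulerChar_symV_mul_add n hk]

end GLTwoInt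

open GLTwoInt in
theorem theorem5p5 :
    (∀ m : ℕ, HasFiniteCohomology (symV m) ∧ HasFiniteCohomology (symVDet m)) ∧
    ∀ n : ℕ,
      (homologicalEulerChar (symV (12 * n)) = -(n : ℤ) + 1 ∧
        homologicalEulerChar (symV (12 * n + 2)) = -(n : ℤ) ∧
        homologicalEulerChar (symV (12 * n + 4)) = -(n : ℤ) ∧
        homologicalEulerChar (symV (12 * n + 6)) = -(n : ℤ) ∧
        homologicalEulerChar (symV (12 * n + 8)) = -(n : ℤ) ∧
        homologicalEulerChar (symV (12 * n + 10)) = -(n : ℤ) - 1 ∧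
        ∀ k : ℕ, Odd k → homologicalEulerChar (symV (12 * n + k)) = 0) ∧
      (homologicalEulerChar (symVDet (12 * n)) = -(n : ℤ) ∧
        homologicalEulerChar (symVDet (12 * n + 2)) = -(n : ℤ) - 1 ∧
        homologicalEulerChar (symVDet (12 * n + 4)) = -(n : ℤ) - 1 ∧
        homologicalEulerChar (symVDet (12 * n + 6)) = -(n : ℤ) - 1 ∧
        homologicalEulerChar (symVDet (12 * n + 8)) = -(n : ℤ) - 1 ∧
        homologicalEulerChar (symVDet (12 * n + 10)) = -(n : ℤ) - 2 ∧
        ∀ k : ℕ, Odd k → homologicalEulerChar (symVDet (12 * n + k)) = 0) := by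
  refine ⟨fun m => ⟨(hasFiniteCohomology_and_eulerChar _).1,
    (hasFiniteCohomology_and_eulerChar _).1⟩, fun n => ?_⟩
  have odd_add {k : ℕ} (hk : Odd k) : Odd (12 * n + k) :=
    ((by decide : Even 12).mul_right n).add_odd hk
  obtain ⟨h0, h2, h4, h6, h8, h10⟩ := eulerChar_symV_small
  refine ⟨⟨?_, ?_, ?_, ?_, ?_, ?_, fun k hk => eulerChar_symV_of_odd (odd_add hk)⟩,
    ⟨?_, ?_, ?_, ?_, ?_, ?_, fun k hk => eulerChar_symVDet_of_odd (odd_add hk)⟩⟩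
  · rw [← add_zero (12 * n), eulerChar_symV_mul_add n (by decide), h0]; ring
  · rw [eulerChar_symV_mul_add n (by decide), h2]; ring
  · rw [eulerChar_symV_mul_add n (by decide), h4]; ring
  · rw [eulerChar_symV_mul_add n (by decide), h6]; ring
  · rw [eulerChar_symV_mul_add n (by decide), h8]; ring
  · rw [eulerChar_symV_mul_add n (by decide), h10]; ring
  · rw [← add_zero (12 * n), eulerChar_symVDet_mul_add n (by decide), h0]; ring
  · rw [eulerChar_symVDet_mul_add n (by decide), h2]; ring
  · rw [eulerChar_symVDet_mul_add n (by decide), h4]; ring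
  · rw [eulerChar_symVDet_mul_add n (by decide), h6]; ring
  · rw [eulerChar_symVDet_mul_add n (by decide), h8]; ring
  · rw [eulerChar_symVDet_mul_add n (by decide), h10]; ring
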